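/- Let $k\ge 3$ and $r$ be integers with $0<r<k/2$. For a partition of a positive integer $n$, let $M$ denote the largest part that is an even multiple of $k$ (that is, a multiple of $2k$), with $M=0$ if no part is an even multiple of $k$. Let $E(n)$ be the number of partitions of $n$ such that - every part is $\equiv \pm r$ or $\equiv 0 \pmod k$, the parts $\equiv\pm r \pmod k$ are distinct, and the parts $\equiv 0 \pmod k$ may repeat; - every even multiple $2k,4k,\dots,M$ of $k$ up to $M$ occurs at least once as a part; - the largest part that is an odd multiple of $k$ (if any) is at most $M+k$; - the largest part $\equiv r \pmod k$ (if any) is smaller than $\frac k2+\frac M2$; - the largest part $\equiv -r \pmod k$ (if any) is smaller than $\frac M2$. Let $F(n)$ be the number of partitions of $n$ in which every part is $\equiv \pm r$ or $\equiv \pm k \pmod{3k}$, the parts $\equiv\pm r \pmod{3k}$ are distinct, and the parts $\equiv \pm k \pmod{3k}$ may repeat. Then $$E(n)=F(n)\qquad\text{for all integers } n\ge 1.$$ -/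

import Mathlib

namespace PartitionEF

/-- The largest part of `p` that is an even multiple of `k`; it is `0` if no part is. -/
def largestEvenMultiple (k : ℕ) {n : ℕ} (p : n.Partition) : ℕ :=
  (p.parts.filter fun i => 2 * k ∣ i).sup

/-- The partitions counted by `E(n)`. An upper bound on the largest part of some kind
(if there is one) is written as an upper bound on all the parts of that kind, and the
bounds `k / 2 + M / 2` and `M / 2` are multiplied by `2`, where `M` is the
largest even multiple of `k` among the parts (`0` if there is none). -/
structure IsCountedByE (k r : ℕ) {n : ℕ} (p : n.Partition) : Prop where
  /-- Every part is `≡ ± r` or `≡ 0` modulo `k`. -/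
  residue : ∀ i ∈ p.parts,
    (i : ℤ) ≡ r [ZMOD k] ∨ (i : ℤ) ≡ -r [ZMOD k] ∨ (i : ℤ) ≡ 0 [ZMOD k]
  /-- The parts `≡ ± r` modulo `k` are distinct. -/
  distinct : ∀ i ∈ p.parts,
    (i : ℤ) ≡ r [ZMOD k] ∨ (i : ℤ) ≡ -r [ZMOD k] → p.parts.count i = 1
  /-- All even multiples of `k` from `2 * k` to the largest one among the parts are parts. -/
  even_multiples : ∀ m, 0 < m → m ≤ largestEvenMultiple k p → 2 * k ∣ m → m ∈ p.parts
  /-- The odd multiples of `k` are at most `k` more than the largest even multiple of `k`. -/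
  odd_multiples : ∀ j, k * (2 * j + 1) ∈ p.parts →
    k * (2 * j + 1) ≤ largestEvenMultiple k p + k
  /-- The parts `≡ r` are smaller than `k / 2` plus half the largest even multiple of `k`. -/
  pos_residue_lt : ∀ i ∈ p.parts, (i : ℤ) ≡ r [ZMOD k] → 2 * i < k + largestEvenMultiple k p
  /-- The parts `≡ -r` are smaller than half the largest even multiple of `k`. -/
  neg_residue_lt : ∀ i ∈ p.parts, (i : ℤ) ≡ -r [ZMOD k] → 2 * i < largestEvenMultiple k p

/-- The partitions counted by `F(n)`. -/
structure IsCountedByF (k r : ℕ) {n : ℕ} (p : n.Partition) : Prop where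
  /-- Every part is `≡ ± r` or `≡ ± k` modulo `3 * k`. -/
  residue : ∀ i ∈ p.parts,
    (i : ℤ) ≡ r [ZMOD 3 * k] ∨ (i : ℤ) ≡ -r [ZMOD 3 * k] ∨
      (i : ℤ) ≡ k [ZMOD 3 * k] ∨ (i : ℤ) ≡ -k [ZMOD 3 * k]
  /-- The parts `≡ ± r` modulo `3 * k` are distinct. -/
  distinct : ∀ i ∈ p.parts,
    (i : ℤ) ≡ r [ZMOD 3 * k] ∨ (i : ℤ) ≡ -r [ZMOD 3 * k] → p.parts.count i = 1

open scoped Classical in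
/-- The number `E(n)`, for given `k` and `r`. -/
noncomputable def E (k r n : ℕ) : ℕ :=
  (Finset.univ.filter fun p : n.Partition => IsCountedByE k r p).card

open scoped Classical in
/-- The number `F(n)`, for given `k` and `r`. -/
noncomputable def F (k r n : ℕ) : ℕ :=
  (Finset.univ.filter fun p : n.Partition => IsCountedByF k r p).card

end PartitionEF

/-! Compare generating functions. Put `Q = x ^ k`, `a = x ^ r`, `b = x ^ (k - r)`, so that `a * b =
Q`. Sorting the partitions counted by `E` by `M = 2 * k * N` gives ∑_N Q^(N(N+1)) (-a;Q)_{N+1}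
(-b;Q)_N / (Q;Q)_{2N+1}, while `F` has the product (-a;Q³)_∞ (-bQ²;Q³)_∞ / ((Q;Q³)_∞ (Q²;Q³)_∞).
`finite_triple_product` expands the N-th summand over s + t = 2N + 1 into theta terms a^j
Q^(j(j-1)/2) / ((Q;Q)_s (Q;Q)_t) with j = s - N. As st = N(N+1) - j(j-1), the factor Q^(N(N+1)) can
be traded for Q^(st) if the base of the theta term becomes Q³ (`thetaTerm_cube`). For fixed j, the
sum of Q^(st) / ((Q;Q)_s (Q;Q)_t) is 1/(Q;Q)_∞ by `durfee_rectangle`. The theta series in base Q³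
that remains is summed by `triple_product`, and (Q³;Q³)_∞ / (Q;Q)_∞ leaves the denominators of the
product for `F`. Only the coefficient of x^n is needed, so everything takes place modulo x^(n+1).
There `Q` is nilpotent, all series and products are finite, and 1/(Q;Q)_m is constant from m = L on,
where `Q ^ L = 0`. -/

namespace PartitionEF

open Finset

/-! ### Theta terms and the finite triple product -/

section Algebra

variable {B : Type*} [CommRing B]

/-- The term of index `j` in the theta series of `∏ (1 + a Q ^ i) (1 + b Q ^ i)`, where
`a * b = Q`: it is `a ^ j * Q ^ (j * (j - 1) / 2)`, with negative powers of `a` written in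
terms of `b`. -/
def thetaTerm (a b Q : B) : ℤ → B
  | .ofNat j => a ^ j * Q ^ j.choose 2
  | .negSucc j => b ^ (j + 1) * Q ^ (j + 1).choose 2

lemma thetaTerm_natCast (a b Q : B) (j : ℕ) :
    thetaTerm a b Q (j : ℤ) = a ^ j * Q ^ j.choose 2 := rfl

lemma thetaTerm_neg_natCast (a b Q : B) (j : ℕ) :
    thetaTerm a b Q (-(j : ℤ)) = b ^ j * Q ^ j.choose 2 := by
  cases j with
  | zero => simp [thetaTerm_natCast a b Q 0 |> fun h => (by simpa using h : thetaTerm a b Q 0 = 1)]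
  | succ j => rfl

lemma thetaTerm_neg (a b Q : B) (j : ℤ) : thetaTerm a b Q (-j) = thetaTerm b a Q j := by
  obtain ⟨i, rfl | rfl⟩ := j.eq_nat_or_neg
  · rw [thetaTerm_neg_natCast, thetaTerm_natCast]
  · rw [neg_neg, thetaTerm_neg_natCast, thetaTerm_natCast]

/-- Formally the ratio of consecutive terms is a Q^j; the extra factor `Q ^ t` keeps all exponents
nonnegative when j < 0. -/
lemma thetaTerm_add_one {a b Q : B} (hab : a * b = Q) {m t : ℕ} {j : ℤ} (h : (m : ℤ) = t + j) :
    a * Q ^ m * thetaTerm a b Q j = Q ^ t * thetaTerm a b Q (j + 1) := by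
  obtain ⟨i, rfl | rfl⟩ := j.eq_nat_or_neg
  · obtain rfl : m = t + i := by omega
    rw [show (i : ℤ) + 1 = ((i + 1 : ℕ) : ℤ) by simp, thetaTerm_natCast, thetaTerm_natCast,
      Nat.choose_succ_succ' i 1, Nat.choose_one_right]
    ring
  · cases i with
    | zero =>
      obtain rfl : m = t := by omega
      have h0 := thetaTerm_natCast a b Q 0
      have h1 := thetaTerm_natCast a b Q 1
      simp at h0 h1
      simp [h0, h1, mul_comm]
    | succ i =>
      obtain rfl : t = m + i + 1 := by omega
      rw [show -((i + 1 : ℕ) : ℤ) + 1 = -(i : ℤ) by simp, thetaTerm_neg_natCast,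
        thetaTerm_neg_natCast, Nat.choose_succ_succ' i 1, Nat.choose_one_right, pow_add Q (m + i) 1,
        pow_one, ← hab]
      ring

lemma thetaTerm_sub_one {a b Q : B} (hab : a * b = Q) {n s : ℕ} {j : ℤ} (h : (n : ℤ) = s - j) :
    b * Q ^ n * thetaTerm a b Q j = Q ^ s * thetaTerm a b Q (j - 1) := by
  have := thetaTerm_add_one (a := b) (b := a) (Q := Q) (by rw [mul_comm, hab])
    (m := n) (t := s) (j := -j) (by omega)
  rwa [thetaTerm_neg, show -j + 1 = -(j - 1) by ring, thetaTerm_neg] at this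

lemma thetaTerm_eq_zero {a b Q : B} {L : ℕ} (hQ : Q ^ L = 0) {j : ℤ} (hj : L < j.natAbs) :
    thetaTerm a b Q j = 0 := by
  have key : ∀ i : ℕ, L < i → Q ^ i.choose 2 = 0 := by
    intro i hi
    refine pow_eq_zero_of_le ?_ hQ
    obtain ⟨i, rfl⟩ : ∃ i', i = i' + 1 := ⟨i - 1, by omega⟩
    rw [Nat.choose_succ_succ' i 1, Nat.choose_one_right]
    omega
  obtain ⟨i, rfl | rfl⟩ := j.eq_nat_or_neg
  · rw [thetaTerm_natCast, key i (by simpa using hj), mul_zero]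
  · rw [thetaTerm_neg_natCast, key i (by simpa using hj), mul_zero]

lemma sq_choose_two (i : ℕ) : i * i = 2 * i.choose 2 + i := by
  induction i with
  | zero => rfl
  | succ i ih => rw [Nat.choose_succ_succ' i 1, Nat.choose_one_right]; linarith

/-- With j = s - N, the identity N(N+1) = st + j(j-1) adds twice j(j-1)/2 to the exponent of the
theta term. The second parameter becomes `b * Q ^ 2` because its product with `a` must be `Q ^ 3`.
-/
lemma thetaTerm_cube (a b Q : B) {N s t : ℕ} (h : s + t = 2 * N + 1) :
    Q ^ (N * (N + 1)) * thetaTerm a b Q (s - N) =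
      Q ^ (s * t) * thetaTerm a (b * Q ^ 2) (Q ^ 3) (s - N) := by
  rcases le_total N s with hs | hs
  · obtain ⟨i, rfl⟩ := Nat.exists_eq_add_of_le hs
    -- Here t = N + 1 - i, so i is at most N + 1, and i = N + 1 is the extreme case t = 0.
    obtain ⟨u, rfl⟩ | h1 : (∃ u, N = i + u) ∨ N + 1 = i := by
      by_cases hi : i ≤ N
      · exact Or.inl (Nat.exists_eq_add_of_le hi)
      · exact Or.inr (by omega)
    · obtain rfl : t = u + 1 := by omega
      rw [show ((i + u + i : ℕ) : ℤ) - (i + u : ℕ) = (i : ℕ) by push_cast; ring, thetaTerm_natCast,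
        thetaTerm_natCast]
      have := sq_choose_two i
      rw [mul_left_comm, mul_left_comm (Q ^ _), ← pow_mul, ← pow_add, ← pow_add]
      congr 2
      nlinarith
    · subst h1
      obtain rfl : t = 0 := by omega
      rw [show ((N + (N + 1) : ℕ) : ℤ) - (N : ℕ) = (N + 1 : ℕ) by push_cast; ring,
        thetaTerm_natCast, thetaTerm_natCast]
      have := sq_choose_two (N + 1)
      rw [mul_left_comm, mul_left_comm (Q ^ _), ← pow_mul, ← pow_add, ← pow_add]
      congr 2
      nlinarith
  · obtain ⟨i, rfl⟩ := Nat.exists_eq_add_of_le hs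
    obtain rfl : t = s + 2 * i + 1 := by omega
    rw [show (s : ℤ) - (s + i : ℕ) = -(i : ℕ) by push_cast; ring, thetaTerm_neg_natCast,
      thetaTerm_neg_natCast, mul_pow, ← pow_mul, ← pow_mul]
    have := sq_choose_two i
    rw [mul_left_comm, mul_assoc (b ^ i), mul_left_comm (Q ^ _) (b ^ i), ← pow_add, ← pow_add,
      ← pow_add]
    congr 2
    nlinarith

variable {a b Q : B} {h : ℕ → B}

/-- The finite form of the Jacobi triple product identity; `h n` stands for `1 / (Q; Q)_n`. -/
lemma finite_triple_product (hQ : IsNilpotent Q) (hab : a * b = Q) (h0 : h 0 = 1)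
    (hh : ∀ n, (1 - Q ^ (n + 1)) * h (n + 1) = h n) (m n : ℕ) :
    ∑ p ∈ antidiagonal (m + n), h p.1 * h p.2 * thetaTerm a b Q (p.1 - n) =
      h (m + n) * ((∏ i ∈ range m, (1 + a * Q ^ i)) * ∏ i ∈ range n, (1 + b * Q ^ i)) := by
  have hu : ∀ N, IsUnit (1 - Q ^ (N + 1)) := fun N =>
    IsNilpotent.isUnit_one_sub (hQ.pow_succ N)
  induction n with
  | zero =>
    induction m with
    | zero => simp [h0, show thetaTerm a b Q 0 = 1 by simpa using thetaTerm_natCast a b Q 0]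
    | succ m ih =>
      refine (hu m).mul_left_cancel ?_
      simp only [add_zero, Nat.cast_zero, sub_zero, prod_range_zero, mul_one] at ih ⊢
      rw [← mul_assoc, hh, prod_range_succ, ← mul_assoc, ← ih, mul_sum]
      -- This is the q-Pascal rule: 1 - Q^(s+t) = (1 - Q^t) + Q^t (1 - Q^s). Each bracket lowers the
      -- index of one `h`.
      have e : ∀ p ∈ antidiagonal (m + 1),
          (1 - Q ^ (m + 1)) * (h p.1 * h p.2 * thetaTerm a b Q p.1) =
          h p.1 * ((1 - Q ^ p.2) * h p.2) * thetaTerm a b Q p.1 +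
          ((1 - Q ^ p.1) * h p.1) * h p.2 * (Q ^ p.2 * thetaTerm a b Q p.1) := by
        intro p hp
        rw [← mem_antidiagonal.1 hp]
        ring
      rw [sum_congr rfl e, sum_add_distrib, Nat.sum_antidiagonal_succ', Nat.sum_antidiagonal_succ]
      simp only [pow_zero, sub_self, zero_mul, mul_zero, zero_add, hh]
      rw [mul_add, mul_one, sum_mul]
      congr 1
      refine sum_congr rfl fun p hp => ?_
      have hp := mem_antidiagonal.1 hp
      push_cast
      rw [← thetaTerm_add_one hab (m := m) (t := p.2) (j := p.1) (by omega)]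
      ring
  | succ n ih =>
    refine (hu (m + n)).mul_left_cancel ?_
    rw [← add_assoc, ← mul_assoc, hh, prod_range_succ, ← mul_assoc (∏ i ∈ range m, _),
      ← mul_assoc (h (m + n)), ← ih, mul_sum]
    -- The mirrored q-Pascal rule, with the roles of s and t exchanged.
    have e : ∀ p ∈ antidiagonal (m + n + 1),
        (1 - Q ^ (m + n + 1)) * (h p.1 * h p.2 * thetaTerm a b Q (p.1 - (n + 1 : ℕ))) =
        ((1 - Q ^ p.1) * h p.1) * h p.2 * thetaTerm a b Q (p.1 - (n + 1 : ℕ)) +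
        h p.1 * ((1 - Q ^ p.2) * h p.2) * (Q ^ p.1 * thetaTerm a b Q (p.1 - (n + 1 : ℕ))) := by
      intro p hp
      rw [← mem_antidiagonal.1 hp]
      ring
    rw [sum_congr rfl e, sum_add_distrib, Nat.sum_antidiagonal_succ, Nat.sum_antidiagonal_succ']
    simp only [pow_zero, sub_self, zero_mul, mul_zero, zero_add, hh]
    rw [mul_add, mul_one, sum_mul]
    congr 1
    · refine sum_congr rfl fun p hp => ?_
      congr 2
      push_cast
      ring
    · refine sum_congr rfl fun p hp => ?_
      rw [show (p.1 : ℤ) - (n + 1 : ℕ) = p.1 - n - 1 by push_cast; ring,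
        ← thetaTerm_sub_one hab (n := n) (s := p.1) (j := p.1 - n) (by omega)]
      ring

/-! ### The Durfee rectangle identity and the summation over N -/

variable {L : ℕ}

lemma eventually_const (hQ : Q ^ L = 0) (hh : ∀ n, (1 - Q ^ (n + 1)) * h (n + 1) = h n) {m : ℕ}
    (hm : L ≤ m) : h m = h L := by
  induction m, hm using Nat.le_induction with
  | base => rfl
  | succ m hm ih => rw [← ih, ← hh m, pow_eq_zero_of_le (by omega) hQ, sub_zero, one_mul]

/-- The Durfee rectangle identity. -/
lemma durfee_rectangle (hQ : Q ^ L = 0) (h0 : h 0 = 1)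
    (hh : ∀ n, (1 - Q ^ (n + 1)) * h (n + 1) = h n) {K : ℕ} (hK : L < K) (c : ℕ) :
    ∑ t ∈ range K, Q ^ (t * (t + c)) * h t * h (t + c) = h L := by
  obtain ⟨K, rfl⟩ : ∃ K', K = K' + 1 := ⟨K - 1, by omega⟩
  set D : ℕ → B := fun c => ∑ t ∈ range (K + 1), Q ^ (t * (t + c)) * h t * h (t + c) with hD
  -- Expand h(t+c) = (1 - Q^(t+c+1)) h(t+c+1) and write 1 - Q^(t+c+1) = (1 - Q^t) + Q^t - Q^(c+1)
  -- Q^t; the part with 1 - Q^t gives D(c+2) after a shift of t.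
  have rec1 : ∀ c, D c - D (c + 1) = Q ^ (c + 1) * (D (c + 2) - D (c + 1)) := by
    intro c
    have e : ∀ t ∈ range (K + 1), Q ^ (t * (t + c)) * h t * h (t + c) =
        Q ^ (t * (t + (c + 1))) * h t * h (t + (c + 1)) +
        Q ^ (t * (t + c)) * ((1 - Q ^ t) * h t) * h (t + c + 1) -
        Q ^ (c + 1) * (Q ^ (t * (t + (c + 1))) * h t * h (t + (c + 1))) := by
      intro t _
      rw [← hh (t + c), ← add_assoc]
      ring
    have e2 : ∑ t ∈ range (K + 1), Q ^ (t * (t + c)) * ((1 - Q ^ t) * h t) * h (t + c + 1) =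
        Q ^ (c + 1) * D (c + 2) := by
      rw [sum_range_succ', hD]
      simp only [hh, pow_zero, sub_self, zero_mul, mul_zero, add_zero]
      rw [sum_range_succ, pow_eq_zero_of_le (m := L) (n := K * (K + (c + 2))) (by nlinarith) hQ,
        zero_mul, zero_mul, add_zero, mul_sum]
      refine sum_congr rfl fun t _ => ?_
      rw [show t + 1 + c + 1 = t + (c + 2) by ring]
      ring
    have : D c = D (c + 1) + Q ^ (c + 1) * D (c + 2) - Q ^ (c + 1) * D (c + 1) := by
      conv_lhs => rw [hD]
      simp only
      rw [sum_congr rfl e, sum_sub_distrib, sum_add_distrib, e2, ← mul_sum]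
    rw [this]
    ring
  -- Each use of the recurrence gains a factor `Q`, so nilpotency makes `D` constant.
  have dvd : ∀ m c, Q ^ m ∣ D c - D (c + 1) := by
    intro m
    induction m with
    | zero => simp
    | succ m ih =>
      intro c
      rw [rec1, pow_succ, mul_comm (Q ^ m)]
      refine mul_dvd_mul (dvd_pow_self Q (by omega)) ?_
      rw [← neg_sub, dvd_neg]
      exact ih (c + 1)
  have step : ∀ c, D c = D (c + 1) := fun c => by
    have := dvd L c
    rwa [hQ, zero_dvd_iff, sub_eq_zero] at this
  have const : ∀ d, D c = D (c + d) := fun d => by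
    induction d with
    | zero => rfl
    | succ d ih => rw [ih, step, add_assoc]
  change D c = h L
  -- At c + L every term with t > 0 contains a power of `Q` that vanishes; only t = 0 survives.
  rw [const L, ← eventually_const hQ hh (Nat.le_add_left L c), hD]
  simp only
  rw [sum_range_succ', sum_eq_zero, zero_add]
  · simp [h0]
  · intro t _
    rw [pow_eq_zero_of_le (by nlinarith) hQ, zero_mul, zero_mul]

/-- An odd total forces s ≠ t, so (s, t) pairs with (t, s). In the theta index j = s - N this swap
is j ↦ 1 - j, whence the pairs i + 1, -i of `thetaPair`. -/
lemma sum_antidiagonal_odd {M : Type*} [AddCommMonoid M] (f : ℕ → ℕ → M) (N : ℕ) :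
    ∑ p ∈ antidiagonal (2 * N + 1), f p.1 p.2 =
      ∑ p ∈ antidiagonal N, (f (p.1 + 2 * p.2 + 1) p.1 + f p.1 (p.1 + 2 * p.2 + 1)) := by
  rw [sum_add_distrib, Nat.sum_antidiagonal_eq_sum_range_succ f,
    Nat.sum_antidiagonal_eq_sum_range_succ (fun x y => f (x + 2 * y + 1) x),
    Nat.sum_antidiagonal_eq_sum_range_succ (fun x y => f x (x + 2 * y + 1)),
    show (2 * N + 1).succ = (N + 1) + (N + 1) by omega, sum_range_add, add_comm]
  congr 1
  · rw [← sum_range_reflect]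
    refine sum_congr rfl fun i hi => ?_
    have := mem_range.1 hi
    congr 1 <;> omega
  · refine sum_congr rfl fun i hi => ?_
    have := mem_range.1 hi
    congr 1
    omega

/-- The support of `g` lies in t < L, i ≤ L, where t + i < K, so triangle and square carry the same
terms. -/
lemma sum_sum_antidiagonal_eq {M : Type*} [AddCommMonoid M] {g : ℕ → ℕ → M} {L K : ℕ}
    (hK : 2 * L < K) (h1 : ∀ t i, L ≤ t → g t i = 0) (h2 : ∀ t i, L < i → g t i = 0) :
    ∑ N ∈ range K, ∑ p ∈ antidiagonal N, g p.1 p.2 = ∑ i ∈ range K, ∑ t ∈ range K, g t i := by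
  simp_rw [Nat.sum_antidiagonal_eq_sum_range_succ g]
  rw [sum_range_diag_flip, sum_comm (s := range K) (t := range K)]
  refine sum_congr rfl fun t _ => ?_
  refine sum_subset (range_mono (Nat.sub_le _ _)) fun i _ hi => ?_
  have : K - t ≤ i := by simpa using hi
  by_cases ht : L ≤ t
  · exact h1 t i ht
  · exact h2 t i (by omega)

/-- The symmetrized terms of the theta series. -/
def thetaPair (a b Q : B) (i : ℕ) : B :=
  thetaTerm a b Q ((i : ℤ) + 1) + thetaTerm a b Q (-(i : ℤ))

lemma thetaPair_eq_zero (hQ : Q ^ L = 0) {i : ℕ} (hi : L < i) : thetaPair a b Q i = 0 := by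
  rw [thetaPair, thetaTerm_eq_zero hQ (by omega), thetaTerm_eq_zero hQ (by omega), add_zero]

/-- The Jacobi triple product identity for nilpotent `Q`. -/
lemma triple_product (hQ : Q ^ L = 0) (hab : a * b = Q) (h0 : h 0 = 1)
    (hh : ∀ n, (1 - Q ^ (n + 1)) * h (n + 1) = h n) (hu : IsUnit (h L)) {m : ℕ} (hm : 2 * L ≤ m) :
    (∏ i ∈ range (m + 1), (1 + a * Q ^ i)) * ∏ i ∈ range m, (1 + b * Q ^ i) =
      h L * ∑ i ∈ range (m + 1), thetaPair a b Q i := by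
  refine hu.mul_left_cancel ?_
  have := finite_triple_product ⟨L, hQ⟩ hab h0 hh (m + 1) m
  rw [eventually_const hQ hh (by omega)] at this
  rw [← this, show m + 1 + m = 2 * m + 1 by ring,
    sum_antidiagonal_odd (fun s t => h s * h t * thetaTerm a b Q (s - m)),
    Nat.sum_antidiagonal_eq_sum_range_succ (fun t i => h (t + 2 * i + 1) * h t *
      thetaTerm a b Q ((t + 2 * i + 1 : ℕ) - m) + h t * h (t + 2 * i + 1) *
      thetaTerm a b Q (t - m)), ← sum_range_reflect, mul_sum, mul_sum]
  refine sum_congr rfl fun i hi => ?_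
  have hi := mem_range.1 hi
  obtain ⟨t, rfl⟩ : ∃ t, m = t + i := ⟨m - i, by omega⟩
  rw [show t + i + 1 - 1 - i = t by omega, show t + i - t = i by omega,
    show ((t + 2 * i + 1 : ℕ) : ℤ) - (t + i : ℕ) = i + 1 by push_cast; ring,
    show (t : ℤ) - (t + i : ℕ) = -i by push_cast; ring]
  -- For i > L the theta terms vanish; for i ≤ L the bound 2L ≤ m gives t ≥ L, so every `h` has its
  -- stable value.
  by_cases hiL : L < i
  · have := thetaPair_eq_zero (a := a) (b := b) hQ hiL
    rw [this]
    rw [thetaPair] at this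
    linear_combination h t * h (t + 2 * i + 1) * this
  · rw [eventually_const hQ hh (by omega : L ≤ t),
      eventually_const hQ hh (by omega : L ≤ t + 2 * i + 1), thetaPair]
    ring

/-- After the change of base, N = t + i splits the double sum: the theta part depends on i alone,
and the sum over t is a Durfee rectangle sum of width excess 2i + 1. -/
lemma sum_triple_products (hQ : Q ^ L = 0) (hab : a * b = Q) (h0 : h 0 = 1)
    (hh : ∀ n, (1 - Q ^ (n + 1)) * h (n + 1) = h n) {K : ℕ} (hK : 2 * L < K) :
    ∑ N ∈ range K, Q ^ (N * (N + 1)) * (h (2 * N + 1) *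
      ((∏ i ∈ range (N + 1), (1 + a * Q ^ i)) * ∏ i ∈ range N, (1 + b * Q ^ i))) =
      h L * ∑ i ∈ range K, thetaPair a (b * Q ^ 2) (Q ^ 3) i := by
  have hQ3 : (Q ^ 3) ^ L = 0 := by rw [← pow_mul, mul_comm, pow_mul, hQ, zero_pow three_ne_zero]
  set g : ℕ → ℕ → B := fun t i => Q ^ (t * (t + (2 * i + 1))) * h t * h (t + (2 * i + 1)) *
    thetaPair a (b * Q ^ 2) (Q ^ 3) i with hg
  have e : ∀ N ∈ range K, Q ^ (N * (N + 1)) * (h (2 * N + 1) *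
      ((∏ i ∈ range (N + 1), (1 + a * Q ^ i)) * ∏ i ∈ range N, (1 + b * Q ^ i))) =
      ∑ p ∈ antidiagonal N, g p.1 p.2 := by
    intro N _
    have := finite_triple_product ⟨L, hQ⟩ hab h0 hh (N + 1) N
    rw [show N + 1 + N = 2 * N + 1 by ring] at this
    rw [← this, mul_sum]
    have e1 : ∀ p ∈ antidiagonal (2 * N + 1),
        Q ^ (N * (N + 1)) * (h p.1 * h p.2 * thetaTerm a b Q (p.1 - N)) =
        Q ^ (p.1 * p.2) * h p.1 * h p.2 * thetaTerm a (b * Q ^ 2) (Q ^ 3) (p.1 - N) := by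
      intro p hp
      linear_combination h p.1 * h p.2 * thetaTerm_cube a b Q (mem_antidiagonal.1 hp)
    rw [sum_congr rfl e1, sum_antidiagonal_odd (fun s t => Q ^ (s * t) * h s * h t *
      thetaTerm a (b * Q ^ 2) (Q ^ 3) (s - N))]
    refine sum_congr rfl fun p hp => ?_
    obtain rfl := mem_antidiagonal.1 hp
    rw [show ((p.1 + 2 * p.2 + 1 : ℕ) : ℤ) - (p.1 + p.2 : ℕ) = p.2 + 1 by push_cast; ring,
      show (p.1 : ℤ) - (p.1 + p.2 : ℕ) = -p.2 by push_cast; ring, hg]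
    simp only [thetaPair, ← add_assoc]
    ring
  rw [sum_congr rfl e, sum_sum_antidiagonal_eq hK, mul_sum]
  · refine sum_congr rfl fun i _ => ?_
    rw [hg]
    simp only
    rw [← sum_mul, durfee_rectangle hQ h0 hh (by omega)]
  · intro t i ht
    rw [hg]
    simp only
    rw [pow_eq_zero_of_le (by nlinarith) hQ, zero_mul, zero_mul, zero_mul]
  · intro t i hi
    rw [hg]
    simp only
    rw [thetaPair_eq_zero hQ3 hi, mul_zero]

/-! ### The identity of generating functions -/

/-- For nilpotent `y`, this is `1 / (1 - y)`. -/
def geomSum (L : ℕ) (y : B) : B := ∑ c ∈ range L, y ^ c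

lemma one_sub_mul_geomSum {y : B} (hy : y ^ L = 0) : (1 - y) * geomSum L y = 1 := by
  rw [geomSum, mul_neg_geom_sum, hy, sub_zero]

/-- The identity of generating functions, in a ring where `Q` is nilpotent. -/
theorem generating_function_identity (hQ : Q ^ L = 0) (hab : a * b = Q) :
    ∑ N ∈ range (2 * L + 1),
      (∏ i ∈ range (N + 1), (1 + a * Q ^ i)) * (∏ i ∈ range N, (1 + b * Q ^ i)) *
      (∏ i ∈ range (N + 1), geomSum L (Q ^ (2 * i + 1))) *
      ∏ i ∈ range N, Q ^ (2 * i + 2) * geomSum L (Q ^ (2 * i + 2)) =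
    (∏ i ∈ range (2 * L + 1), (1 + a * (Q ^ 3) ^ i)) *
      (∏ i ∈ range (2 * L), (1 + b * Q ^ 2 * (Q ^ 3) ^ i)) *
      (∏ i ∈ range (2 * L), geomSum L (Q ^ (3 * i + 1))) *
      ∏ i ∈ range (2 * L), geomSum L (Q ^ (3 * i + 2)) := by
  have hQp : ∀ i, (Q ^ i) ^ L = 0 ∨ i = 0 := fun i => by
    rcases Nat.eq_zero_or_pos i with h | h
    · exact Or.inr h
    · left; rw [← pow_mul]; exact pow_eq_zero_of_le (Nat.le_mul_of_pos_left L h) hQ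
  have hQ3 : (Q ^ 3) ^ L = 0 := (hQp 3).resolve_right three_ne_zero
  have inv : ∀ i, (1 - Q ^ (i + 1)) * geomSum L (Q ^ (i + 1)) = 1 := fun i =>
    one_sub_mul_geomSum ((hQp (i + 1)).resolve_right i.succ_ne_zero)
  have inv3 : ∀ i, (1 - (Q ^ 3) ^ (i + 1)) * geomSum L ((Q ^ 3) ^ (i + 1)) = 1 := fun i =>
    one_sub_mul_geomSum (by rw [← pow_mul Q 3]; exact (hQp (3 * (i + 1))).resolve_right (by omega))
  set h : ℕ → B := fun m => ∏ i ∈ range m, geomSum L (Q ^ (i + 1)) with hdef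
  set h3 : ℕ → B := fun m => ∏ i ∈ range m, geomSum L ((Q ^ 3) ^ (i + 1)) with h3def
  have hh : ∀ n, (1 - Q ^ (n + 1)) * h (n + 1) = h n := fun n => by
    rw [hdef]; simp only; rw [prod_range_succ]; linear_combination (h n) * inv n
  have hh3 : ∀ n, (1 - (Q ^ 3) ^ (n + 1)) * h3 (n + 1) = h3 n := fun n => by
    rw [h3def]; simp only; rw [prod_range_succ]; linear_combination (h3 n) * inv3 n
  have hu3 : IsUnit (h3 L) := by
    refine IsUnit.prod_iff.2 fun i _ => IsUnit.of_mul_eq_one (1 - (Q ^ 3) ^ (i + 1)) ?_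
    rw [mul_comm, inv3]
  have odd_even : ∀ N, h (2 * N + 1) = (∏ i ∈ range (N + 1), geomSum L (Q ^ (2 * i + 1))) *
      ∏ i ∈ range N, geomSum L (Q ^ (2 * i + 2)) := fun N => by
    induction N with
    | zero => simp [hdef]
    | succ N ih =>
      rw [show 2 * (N + 1) + 1 = 2 * N + 1 + 1 + 1 by ring, hdef]
      simp only
      rw [prod_range_succ, prod_range_succ _ (2 * N + 1), prod_range_succ _ (N + 1),
        prod_range_succ (fun i => geomSum L (Q ^ (2 * i + 2))) N]
      rw [show 2 * (N + 1) + 1 = 2 * N + 1 + 1 + 1 by ring]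
      linear_combination geomSum L (Q ^ (2 * N + 1 + 1)) * geomSum L (Q ^ (2 * N + 1 + 1 + 1)) * ih
  have pow_prod : ∀ N, ∏ i ∈ range N, Q ^ (2 * i + 2) = Q ^ (N * (N + 1)) := fun N => by
    induction N with
    | zero => simp
    | succ N ih => rw [prod_range_succ, ih]; ring
  have mod3 : ∀ m, h (3 * m) = h3 m * ((∏ i ∈ range m, geomSum L (Q ^ (3 * i + 1))) *
      ∏ i ∈ range m, geomSum L (Q ^ (3 * i + 2))) := fun m => by
    induction m with
    | zero => simp [hdef, h3def]
    | succ m ih =>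
      rw [show 3 * (m + 1) = 3 * m + 1 + 1 + 1 by ring]
      have e : ∀ n, h (n + 1) = h n * geomSum L (Q ^ (n + 1)) := fun n => prod_range_succ _ _
      have e3 : h3 (m + 1) = h3 m * geomSum L ((Q ^ 3) ^ (m + 1)) := prod_range_succ _ _
      rw [e, e, e, ih, e3, prod_range_succ, prod_range_succ, ← pow_mul]
      rw [show 3 * (m + 1) = 3 * m + 1 + 1 + 1 by ring]
      ring
  have hS := sum_triple_products hQ hab (by simp [hdef]) hh (K := 2 * L + 1) (by omega)
  have hT := triple_product (a := a) (b := b * Q ^ 2) hQ3 (by rw [← mul_assoc, hab]; ring)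
    (by simp [h3def]) hh3 hu3 (le_refl (2 * L))
  -- The stable value of `h3` supplies the exponents divisible by 3; together with the two other
  -- residue classes it gives `h (3 * (2 * L))`, which equals `h L`.
  rw [mul_assoc, hT, mul_right_comm, ← eventually_const hQ3 hh3 (by omega : L ≤ 2 * L), ← mod3,
    eventually_const hQ hh (by omega), ← hS]
  refine sum_congr rfl fun N _ => ?_
  rw [odd_even, prod_mul_distrib, pow_prod]
  ring

end Algebra

/-! ### Partitions as multiplicity functions -/

section Counting

lemma count_parts_le {n : ℕ} (p : n.Partition) (i : ℕ) : p.parts.count i ≤ n := by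
  have := Multiset.card_nsmul_le_sum (s := p.parts) (a := 1) fun x hx => p.parts_pos hx
  rw [p.parts_sum, smul_eq_mul, mul_one] at this
  exact (Multiset.count_le_card i p.parts).trans this

open scoped Classical in
/-- The generating function of partitions with prescribed sets of parts and multiplicities. -/
lemma coeff_prod_sum_X_pow (I : Finset ℕ) (hI : ∀ i ∈ I, 0 < i) (S : ℕ → Finset ℕ) (n : ℕ) :
    (∏ i ∈ I, ∑ c ∈ S i, (Polynomial.X : Polynomial ℤ) ^ (i * c)).coeff n =
      (univ.filter fun p : n.Partition =>
        (∀ i ∈ p.parts, i ∈ I) ∧ ∀ i ∈ I, p.parts.count i ∈ S i).card := by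
  rw [prod_sum, Polynomial.finsetSum_coeff]
  simp_rw [prod_pow_eq_pow_sum, Polynomial.coeff_X_pow]
  rw [sum_boole, Nat.cast_inj]
  symm
  refine card_bij (fun p _ i _ => p.parts.count i) ?_ ?_ ?_
  · intro p hp
    obtain ⟨h1, h2⟩ := (mem_filter.1 hp).2
    refine mem_filter.2 ⟨mem_pi.2 fun i hi => h2 i hi, ?_⟩
    rw [sum_attach I fun i => i * p.parts.count i]
    conv_lhs => rw [← p.parts_sum, sum_multiset_count_of_subset p.parts I
      fun i hi => h1 i (Multiset.mem_toFinset.1 hi)]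
    exact sum_congr rfl fun i _ => by rw [smul_eq_mul, mul_comm]
  · intro p hp q hq h
    refine Nat.Partition.ext (Multiset.ext.2 fun i => ?_)
    by_cases hi : i ∈ I
    · exact congrFun (congrFun h i) hi
    · rw [Multiset.count_eq_zero_of_notMem fun h => hi ((mem_filter.1 hp).2.1 i h),
        Multiset.count_eq_zero_of_notMem fun h => hi ((mem_filter.1 hq).2.1 i h)]
  · intro f hf
    obtain ⟨hf1, hf2⟩ := mem_filter.1 hf
    set g : ℕ → ℕ := fun i => if h : i ∈ I then f i h else 0 with hg
    have hgf : ∀ i (h : i ∈ I), g i = f i h := fun i h => dif_pos h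
    set m : Multiset ℕ := ∑ i ∈ I, Multiset.replicate (g i) i with hm
    have hcount : ∀ i ∈ I, m.count i = g i := by
      intro i hi
      rw [hm, Multiset.count_sum']
      simp_rw [Multiset.count_replicate]
      rw [sum_ite_eq' I i, if_pos hi]
    have hmem : ∀ i ∈ m, i ∈ I := by
      intro i hi
      obtain ⟨j, hj, hij⟩ := Multiset.mem_sum.1 hi
      rwa [Multiset.eq_of_mem_replicate hij]
    have hsum : m.sum = n := by
      rw [hf2, sum_multiset_count_of_subset m I fun i hi => hmem i (Multiset.mem_toFinset.1 hi),
        ← sum_attach]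
      exact sum_congr rfl fun i _ => by
        rw [hcount i i.2, hgf i i.2, smul_eq_mul, mul_comm]
    refine ⟨⟨m, fun {i} hi => hI i (hmem i hi), hsum⟩, ?_, ?_⟩
    · refine mem_filter.2 ⟨mem_univ _, hmem, fun i hi => ?_⟩
      rw [hcount i hi, hgf i hi]
      exact mem_pi.1 hf1 i hi
    · funext i hi
      exact (hcount i hi).trans (hgf i hi)

end Counting

/-! ### Residue classes and divisibility -/

section Residues

lemma modEq_iff_exists {K s : ℕ} (hs : s < K) (i : ℕ) :
    (i : ℤ) ≡ s [ZMOD K] ↔ ∃ j, i = s + K * j := by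
  rw [Int.natCast_modEq_iff]
  constructor
  · intro h
    refine ⟨i / K, ?_⟩
    have h' : i % K = s := by rw [h, Nat.mod_eq_of_lt hs]
    have := Nat.mod_add_div i K
    omega
  · rintro ⟨j, rfl⟩
    simp [Nat.ModEq]

lemma modEq_neg_iff_exists {K s : ℕ} (h0 : 0 < s) (hs : s ≤ K) (i : ℕ) :
    (i : ℤ) ≡ -s [ZMOD K] ↔ ∃ j, i = (K - s) + K * j := by
  rw [← modEq_iff_exists (by omega)]
  have : (-s : ℤ) ≡ ((K - s : ℕ) : ℤ) [ZMOD K] := by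
    rw [Nat.cast_sub hs, Int.modEq_iff_dvd]
    exact ⟨1, by ring⟩
  exact ⟨fun h => h.trans this, fun h => h.trans this.symm⟩

lemma not_dvd_add_mul {k s : ℕ} (h0 : 0 < s) (hs : s < k) (i : ℕ) : ¬ k ∣ s + k * i := fun h =>
  absurd (Nat.le_of_dvd h0 ((Nat.dvd_add_left (dvd_mul_right k i)).1 h)) (by omega)

lemma not_two_mul_dvd {k : ℕ} (hk : 0 < k) (i : ℕ) : ¬ 2 * k ∣ k * (2 * i + 1) := by
  rw [mul_comm 2 k, Nat.mul_dvd_mul_iff_left hk]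
  omega

lemma dvd_multiset_sup {d : ℕ} (s : Multiset ℕ) (h : ∀ x ∈ s, d ∣ x) : d ∣ s.sup := by
  induction s using Multiset.induction with
  | empty => simp
  | cons a s ih =>
    have h1 := h a (Multiset.mem_cons_self a s)
    have h2 := ih fun x hx => h x (Multiset.mem_cons_of_mem hx)
    rw [Multiset.sup_cons]
    rcases le_total a s.sup with h | h
    · rwa [sup_eq_right.2 h]
    · rwa [sup_eq_left.2 h]

end Residues

/-! ### Admissible parts and multiplicities -/

/-- The possible parts of a partition counted by `E` whose largest even multiple of `k` is
`2 * k * N`. -/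
def partsE (k r N : ℕ) : Finset ℕ :=
  (((range (N + 1)).image (fun i => r + k * i) ∪ (range N).image (fun i => (k - r) + k * i)) ∪
    (range (N + 1)).image (fun i => k * (2 * i + 1))) ∪ (range N).image (fun i => k * (2 * i + 2))

/-- The allowed multiplicities (up to `L`) of the part `i` in a partition counted by `E`. -/
def multsE (k L i : ℕ) : Finset ℕ :=
  if k ∣ i then if 2 * k ∣ i then Ico 1 (L + 1) else range L else range 2

/-- The possible parts (up to a bound depending on `m`) of a partition counted by `F`. -/
def partsF (k r m : ℕ) : Finset ℕ :=
  (((range (m + 1)).image (fun i => r + 3 * k * i) ∪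
    (range m).image (fun i => (3 * k - r) + 3 * k * i)) ∪
    (range m).image (fun i => k * (3 * i + 1))) ∪ (range m).image (fun i => k * (3 * i + 2))

/-- The allowed multiplicities (below `L`) of the part `i` in a partition counted by `F`. -/
def multsF (k L i : ℕ) : Finset ℕ := if k ∣ i then range L else range 2

lemma mem_partsE {k r N i : ℕ} : i ∈ partsE k r N ↔
    (∃ j < N + 1, r + k * j = i) ∨ (∃ j < N, (k - r) + k * j = i) ∨
    (∃ j < N + 1, k * (2 * j + 1) = i) ∨ ∃ j < N, k * (2 * j + 2) = i := by
  simp only [partsE, mem_union, mem_image, mem_range, or_assoc]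

lemma mem_partsF {k r m i : ℕ} : i ∈ partsF k r m ↔
    (∃ j < m + 1, r + 3 * k * j = i) ∨ (∃ j < m, (3 * k - r) + 3 * k * j = i) ∨
    (∃ j < m, k * (3 * j + 1) = i) ∨ ∃ j < m, k * (3 * j + 2) = i := by
  simp only [partsF, mem_union, mem_image, mem_range, or_assoc]

section Products

variable {k r : ℕ} (hr : 0 < r) (hrk : 2 * r < k)
include hr hrk

lemma add_mul_ne_sub_add_mul (i j : ℕ) : r + k * i ≠ (k - r) + k * j := fun h => by
  have := congrArg (· % k) h
  simp only [Nat.add_mul_mod_self_left] at this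
  rw [Nat.mod_eq_of_lt (by omega), Nat.mod_eq_of_lt (by omega)] at this
  omega

lemma multsE_pos (L i : ℕ) : multsE k L (r + k * i) = range 2 :=
  if_neg (not_dvd_add_mul hr (by omega) i)

lemma multsE_neg (L i : ℕ) : multsE k L ((k - r) + k * i) = range 2 :=
  if_neg (not_dvd_add_mul (by omega) (by omega) i)

lemma multsE_odd (L i : ℕ) : multsE k L (k * (2 * i + 1)) = range L := by
  rw [multsE, if_pos (dvd_mul_right _ _), if_neg (not_two_mul_dvd (by omega) i)]

omit hr hrk in
lemma multsE_even (L i : ℕ) : multsE k L (k * (2 * i + 2)) = Ico 1 (L + 1) := by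
  rw [multsE, if_pos (dvd_mul_right _ _), if_pos ⟨i + 1, by ring⟩]

lemma not_dvd_three_mul_pos (i : ℕ) : ¬ k ∣ r + 3 * k * i := by
  rw [show r + 3 * k * i = r + k * (3 * i) by ring]
  exact not_dvd_add_mul hr (by omega) _

lemma not_dvd_three_mul_neg (i : ℕ) : ¬ k ∣ (3 * k - r) + 3 * k * i := by
  rw [show 3 * k - r + 3 * k * i = (k - r) + k * (3 * i + 2) by
    rw [show 3 * k - r = k - r + 2 * k by omega]; ring]
  exact not_dvd_add_mul (by omega) (by omega) _

lemma prod_partsE {B : Type*} [CommRing B] (x : B) (L N : ℕ) :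
    ∏ i ∈ partsE k r N, ∑ c ∈ multsE k L i, x ^ (i * c) =
      (∏ i ∈ range (N + 1), (1 + x ^ r * (x ^ k) ^ i)) *
      (∏ i ∈ range N, (1 + x ^ (k - r) * (x ^ k) ^ i)) *
      (∏ i ∈ range (N + 1), geomSum L ((x ^ k) ^ (2 * i + 1))) *
      ∏ i ∈ range N, (x ^ k) ^ (2 * i + 2) * geomSum L ((x ^ k) ^ (2 * i + 2)) := by
  have hk : 0 < k := by omega
  rw [partsE, prod_union, prod_union, prod_union, prod_image, prod_image, prod_image, prod_image]
  · simp_rw [multsE_pos hr hrk, multsE_neg hr hrk, multsE_odd hr hrk, multsE_even]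
    congr 1
    · congr 1
      · congr 1 <;> refine prod_congr rfl fun i _ => ?_ <;>
          simp [sum_range_succ, pow_add, pow_mul]
      · refine prod_congr rfl fun i _ => sum_congr rfl fun c _ => ?_
        simp only [← pow_mul]
    · refine prod_congr rfl fun i _ => ?_
      -- Even multiples of `k` must occur, so their multiplicities start at 1; this produces the
      -- prefactor `(x ^ k) ^ (2 * i + 2)`.
      rw [sum_Ico_eq_sum_range, geomSum, mul_sum, Nat.add_sub_cancel]
      refine sum_congr rfl fun c _ => ?_
      simp only [← pow_mul, ← pow_add]
      congr 1
      ring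
  · intro i _ j _ h
    simpa [hk.ne'] using h
  · intro i _ j _ h
    simpa [hk.ne'] using h
  · intro i _ j _ h
    simpa [hk.ne'] using h
  · intro i _ j _ h
    simpa [hk.ne'] using h
  · rw [disjoint_left]
    intro x hx hx'
    obtain ⟨i, -, rfl⟩ := mem_image.1 hx
    obtain ⟨j, -, h⟩ := mem_image.1 hx'
    exact add_mul_ne_sub_add_mul hr hrk i j h.symm
  · rw [disjoint_left]
    intro x hx hx'
    obtain ⟨j, -, rfl⟩ := mem_image.1 hx'
    rcases mem_union.1 hx with hx | hx <;> obtain ⟨i, -, h⟩ := mem_image.1 hx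
    · exact not_dvd_add_mul hr (by omega) i ⟨_, h⟩
    · exact not_dvd_add_mul (by omega) (by omega) i ⟨_, h⟩
  · rw [disjoint_left]
    intro x hx hx'
    obtain ⟨j, -, rfl⟩ := mem_image.1 hx'
    rcases mem_union.1 hx with hx | hx
    · rcases mem_union.1 hx with hx | hx <;> obtain ⟨i, -, h⟩ := mem_image.1 hx
      · exact not_dvd_add_mul hr (by omega) i ⟨_, h⟩
      · exact not_dvd_add_mul (by omega) (by omega) i ⟨_, h⟩
    · obtain ⟨i, -, h⟩ := mem_image.1 hx
      have := Nat.eq_of_mul_eq_mul_left hk h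
      omega

lemma prod_partsF {B : Type*} [CommRing B] (x : B) (L m : ℕ) :
    ∏ i ∈ partsF k r m, ∑ c ∈ multsF k L i, x ^ (i * c) =
      (∏ i ∈ range (m + 1), (1 + x ^ r * ((x ^ k) ^ 3) ^ i)) *
      (∏ i ∈ range m, (1 + x ^ (k - r) * (x ^ k) ^ 2 * ((x ^ k) ^ 3) ^ i)) *
      (∏ i ∈ range m, geomSum L ((x ^ k) ^ (3 * i + 1))) *
      ∏ i ∈ range m, geomSum L ((x ^ k) ^ (3 * i + 2)) := by
  have hk : 0 < k := by omega
  have h1 : ∀ i, multsF k L (r + 3 * k * i) = range 2 := fun i =>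
    if_neg (not_dvd_three_mul_pos hr hrk i)
  have h2 : ∀ i, multsF k L ((3 * k - r) + 3 * k * i) = range 2 := fun i =>
    if_neg (not_dvd_three_mul_neg hr hrk i)
  have h3 : ∀ i, multsF k L (k * i) = range L := fun i => if_pos (dvd_mul_right _ _)
  rw [partsF, prod_union, prod_union, prod_union, prod_image, prod_image, prod_image, prod_image]
  · simp_rw [h1, h2, h3]
    congr 1
    · congr 1
      · congr 1 <;> refine prod_congr rfl fun i _ => ?_
        · simp only [sum_range_succ, sum_range_zero, mul_zero, mul_one, pow_zero, zero_add,
            ← pow_mul, ← pow_add]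
          congr 2
          ring
        · simp only [sum_range_succ, sum_range_zero, mul_zero, mul_one, pow_zero, zero_add,
            ← pow_mul, ← pow_add]
          rw [show 3 * k - r = k - r + 2 * k by omega]
          congr 2
          ring
      · refine prod_congr rfl fun i _ => sum_congr rfl fun c _ => ?_
        simp only [← pow_mul]
    · refine prod_congr rfl fun i _ => sum_congr rfl fun c _ => ?_
      simp only [← pow_mul]
  · intro i _ j _ h
    simpa [hk.ne'] using h
  · intro i _ j _ h
    simpa [hk.ne'] using h
  · intro i _ j _ h
    simpa [hk.ne'] using h
  · intro i _ j _ h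
    simpa [hk.ne'] using h
  · rw [disjoint_left]
    intro x hx hx'
    obtain ⟨i, -, rfl⟩ := mem_image.1 hx
    obtain ⟨j, -, h⟩ := mem_image.1 hx'
    exact add_mul_ne_sub_add_mul hr (by omega : 2 * r < 3 * k) i j h.symm
  · rw [disjoint_left]
    intro x hx hx'
    obtain ⟨j, -, rfl⟩ := mem_image.1 hx'
    rcases mem_union.1 hx with hx | hx <;> obtain ⟨i, -, h⟩ := mem_image.1 hx
    · exact not_dvd_three_mul_pos hr hrk i ⟨_, h⟩
    · exact not_dvd_three_mul_neg hr hrk i ⟨_, h⟩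
  · rw [disjoint_left]
    intro x hx hx'
    obtain ⟨j, -, rfl⟩ := mem_image.1 hx'
    rcases mem_union.1 hx with hx | hx
    · rcases mem_union.1 hx with hx | hx <;> obtain ⟨i, -, h⟩ := mem_image.1 hx
      · exact not_dvd_three_mul_pos hr hrk i ⟨_, h⟩
      · exact not_dvd_three_mul_neg hr hrk i ⟨_, h⟩
    · obtain ⟨i, -, h⟩ := mem_image.1 hx
      have := Nat.eq_of_mul_eq_mul_left hk h
      omega

omit hr hrk in
lemma count_eq_one_of_mem_range_two {n i : ℕ} {p : n.Partition} (hi : i ∈ p.parts)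
    (h : p.parts.count i ∈ range 2) : p.parts.count i = 1 := by
  have := Multiset.one_le_count_iff_mem.2 hi
  have := mem_range.1 h
  omega

omit hr hrk in
lemma count_mem_range_two {n i : ℕ} {p : n.Partition} (h : i ∈ p.parts → p.parts.count i = 1) :
    p.parts.count i ∈ range 2 := by
  by_cases hi : i ∈ p.parts
  · simp [h hi]
  · simp [Multiset.count_eq_zero_of_notMem hi]

/-- The cutoffs lose nothing, since parts and multiplicities are at most n; `2 * (n + 1)` is the
length of the products in `generating_function_identity` for L = n + 1. -/
lemma isCountedByF_iff {n : ℕ} (p : n.Partition) : IsCountedByF k r p ↔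
    (∀ i ∈ p.parts, i ∈ partsF k r (2 * (n + 1))) ∧
      ∀ i ∈ partsF k r (2 * (n + 1)), p.parts.count i ∈ multsF k (n + 1) i := by
  have hk : 0 < k := by omega
  have c1 : ∀ i : ℕ, (i : ℤ) ≡ r [ZMOD 3 * k] ↔ ∃ j, i = r + 3 * k * j := fun i => by
    exact_mod_cast modEq_iff_exists (K := 3 * k) (s := r) (by omega) i
  have c2 : ∀ i : ℕ, (i : ℤ) ≡ -r [ZMOD 3 * k] ↔ ∃ j, i = (3 * k - r) + 3 * k * j := fun i => by
    exact_mod_cast modEq_neg_iff_exists (K := 3 * k) (s := r) (by omega) (by omega) i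
  have c3 : ∀ i : ℕ, (i : ℤ) ≡ k [ZMOD 3 * k] ↔ ∃ j, i = k + 3 * k * j := fun i => by
    exact_mod_cast modEq_iff_exists (K := 3 * k) (s := k) (by omega) i
  have c4 : ∀ i : ℕ, (i : ℤ) ≡ -k [ZMOD 3 * k] ↔ ∃ j, i = (3 * k - k) + 3 * k * j := fun i => by
    exact_mod_cast modEq_neg_iff_exists (K := 3 * k) (s := k) (by omega) (by omega) i
  constructor
  · intro h
    constructor
    · intro i hi
      have hin := p.le_of_mem_parts hi
      rw [mem_partsF]
      rcases h.residue i hi with h | h | h | h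
      · obtain ⟨j, rfl⟩ := (c1 i).1 h
        exact Or.inl ⟨j, by nlinarith, rfl⟩
      · obtain ⟨j, rfl⟩ := (c2 i).1 h
        exact Or.inr (Or.inl ⟨j, by nlinarith, rfl⟩)
      · obtain ⟨j, rfl⟩ := (c3 i).1 h
        exact Or.inr (Or.inr (Or.inl ⟨j, by nlinarith, by ring⟩))
      · obtain ⟨j, rfl⟩ := (c4 i).1 h
        refine Or.inr (Or.inr (Or.inr ⟨j, by nlinarith, ?_⟩))
        rw [show 3 * k - k = 2 * k by omega]
        ring
    · intro i hi
      rw [multsF]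
      split_ifs with hd
      · exact mem_range.2 (Nat.lt_succ_of_le (count_parts_le p i))
      · refine count_mem_range_two fun hip => h.distinct i hip ?_
        rw [c1, c2]
        rcases mem_partsF.1 hi with ⟨j, -, rfl⟩ | ⟨j, -, rfl⟩ | ⟨j, -, rfl⟩ | ⟨j, -, rfl⟩
        · exact Or.inl ⟨j, rfl⟩
        · exact Or.inr ⟨j, rfl⟩
        · exact absurd (dvd_mul_right _ _) hd
        · exact absurd (dvd_mul_right _ _) hd
  · rintro ⟨h1, h2⟩
    constructor
    · intro i hi
      rw [c1, c2, c3, c4]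
      rcases mem_partsF.1 (h1 i hi) with ⟨j, -, rfl⟩ | ⟨j, -, rfl⟩ | ⟨j, -, rfl⟩ | ⟨j, -, rfl⟩
      · exact Or.inl ⟨j, rfl⟩
      · exact Or.inr (Or.inl ⟨j, rfl⟩)
      · exact Or.inr (Or.inr (Or.inl ⟨j, by ring⟩))
      · refine Or.inr (Or.inr (Or.inr ⟨j, ?_⟩))
        rw [show 3 * k - k = 2 * k by omega]
        ring
    · intro i hi hmod
      have hc := h2 i (h1 i hi)
      rw [multsF, if_neg] at hc
      · exact count_eq_one_of_mem_range_two hi hc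
      · rw [c1, c2] at hmod
        rcases hmod with ⟨j, rfl⟩ | ⟨j, rfl⟩
        · exact not_dvd_three_mul_pos hr hrk j
        · exact not_dvd_three_mul_neg hr hrk j

/-- Once M = 2kN is fixed, every bound in the definition becomes a bound on a quotient by `k`: at
most N for the classes r and k mod 2k, less than N for -r. Conversely, the compulsory even multiples
recover M. -/
lemma isCountedByE_iff {n : ℕ} (p : n.Partition) (N : ℕ) :
    (IsCountedByE k r p ∧ largestEvenMultiple k p = 2 * k * N) ↔
    (∀ i ∈ p.parts, i ∈ partsE k r N) ∧
      ∀ i ∈ partsE k r N, p.parts.count i ∈ multsE k (n + 1) i := by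
  have hk : 0 < k := by omega
  have c1 : ∀ i : ℕ, (i : ℤ) ≡ r [ZMOD k] ↔ ∃ j, i = r + k * j :=
    modEq_iff_exists (by omega)
  have c2 : ∀ i : ℕ, (i : ℤ) ≡ -r [ZMOD k] ↔ ∃ j, i = (k - r) + k * j :=
    modEq_neg_iff_exists (by omega) (by omega)
  have c3 : ∀ i : ℕ, (i : ℤ) ≡ 0 [ZMOD k] ↔ k ∣ i := fun i => by
    rw [Int.modEq_zero_iff_dvd, Int.natCast_dvd_natCast]
  constructor
  · rintro ⟨h, hM⟩
    constructor
    · intro i hi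
      rw [mem_partsE]
      rcases h.residue i hi with h' | h' | h'
      · have hlt := h.pos_residue_lt i hi h'
        obtain ⟨j, rfl⟩ := (c1 i).1 h'
        rw [hM] at hlt
        exact Or.inl ⟨j, by by_contra hc; push Not at hc; nlinarith, rfl⟩
      · have hlt := h.neg_residue_lt i hi h'
        obtain ⟨j, rfl⟩ := (c2 i).1 h'
        rw [hM] at hlt
        refine Or.inr (Or.inl ⟨j, ?_, rfl⟩)
        by_contra hc
        push Not at hc
        have : k * N ≤ k * j := Nat.mul_le_mul_left k hc
        have : 2 * k * N = 2 * (k * N) := mul_assoc _ _ _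
        omega
      · obtain ⟨j, rfl⟩ := (c3 i).1 h'
        have hpos := p.parts_pos hi
        rcases Nat.even_or_odd' j with ⟨t, rfl | rfl⟩
        · obtain ⟨t, rfl⟩ : ∃ u, t = u + 1 :=
            Nat.exists_eq_succ_of_ne_zero (by rintro rfl; simp at hpos)
          have hle : k * (2 * (t + 1)) ≤ largestEvenMultiple k p :=
            Multiset.le_sup (Multiset.mem_filter.2 ⟨hi, ⟨t + 1, by ring⟩⟩)
          rw [hM, show k * (2 * (t + 1)) = 2 * k * (t + 1) by ring] at hle
          exact Or.inr (Or.inr (Or.inr ⟨t, Nat.le_of_mul_le_mul_left hle (by omega), by ring⟩))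
        · have hle := h.odd_multiples t hi
          rw [hM, show 2 * k * N + k = k * (2 * N + 1) by ring] at hle
          have := Nat.le_of_mul_le_mul_left hle hk
          exact Or.inr (Or.inr (Or.inl ⟨t, by omega, rfl⟩))
    · intro i hi
      rcases mem_partsE.1 hi with ⟨j, hj, rfl⟩ | ⟨j, hj, rfl⟩ | ⟨j, hj, rfl⟩ | ⟨j, hj, rfl⟩
      · rw [multsE_pos hr hrk]
        exact count_mem_range_two fun hip => h.distinct _ hip (Or.inl ((c1 _).2 ⟨j, rfl⟩))
      · rw [multsE_neg hr hrk]
        exact count_mem_range_two fun hip => h.distinct _ hip (Or.inr ((c2 _).2 ⟨j, rfl⟩))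
      · rw [multsE_odd hr hrk]
        exact mem_range.2 (Nat.lt_succ_of_le (count_parts_le p _))
      · rw [multsE_even]
        have hip := h.even_multiples (k * (2 * j + 2)) (by positivity) (by rw [hM]; nlinarith)
          ⟨j + 1, by ring⟩
        have := count_parts_le p (k * (2 * j + 2))
        exact mem_Ico.2 ⟨Multiset.one_le_count_iff_mem.2 hip, by omega⟩
  · rintro ⟨h1, h2⟩
    have heven : ∀ j < N, k * (2 * j + 2) ∈ p.parts := fun j hj => by
      have := h2 _ (mem_partsE.2 (Or.inr (Or.inr (Or.inr ⟨j, hj, rfl⟩))))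
      rw [multsE_even] at this
      exact Multiset.one_le_count_iff_mem.1 (mem_Ico.1 this).1
    have hM : largestEvenMultiple k p = 2 * k * N := by
      refine le_antisymm (Multiset.sup_le.2 fun i hi => ?_) ?_
      · obtain ⟨hi, hd⟩ := Multiset.mem_filter.1 hi
        have hd' : k ∣ i := (dvd_mul_left k 2).trans hd
        rcases mem_partsE.1 (h1 i hi) with ⟨j, hj, rfl⟩ | ⟨j, hj, rfl⟩ | ⟨j, hj, rfl⟩ | ⟨j, hj, rfl⟩
        · exact absurd hd' (not_dvd_add_mul hr (by omega) j)
        · exact absurd hd' (not_dvd_add_mul (by omega) (by omega) j)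
        · exact absurd hd (not_two_mul_dvd hk j)
        · nlinarith
      · cases N with
        | zero => simp
        | succ N =>
          refine Multiset.le_sup (Multiset.mem_filter.2 ⟨?_, dvd_mul_right _ _⟩)
          have := heven N (Nat.lt_succ_self N)
          rwa [show k * (2 * N + 2) = 2 * k * (N + 1) by ring] at this
    refine ⟨⟨?_, ?_, ?_, ?_, ?_, ?_⟩, hM⟩
    · intro i hi
      rw [c1, c2, c3]
      rcases mem_partsE.1 (h1 i hi) with ⟨j, -, rfl⟩ | ⟨j, -, rfl⟩ | ⟨j, -, rfl⟩ | ⟨j, -, rfl⟩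
      · exact Or.inl ⟨j, rfl⟩
      · exact Or.inr (Or.inl ⟨j, rfl⟩)
      · exact Or.inr (Or.inr (dvd_mul_right _ _))
      · exact Or.inr (Or.inr (dvd_mul_right _ _))
    · intro i hi hmod
      have hc := h2 i (h1 i hi)
      rw [c1, c2] at hmod
      rcases hmod with ⟨j, rfl⟩ | ⟨j, rfl⟩
      · rw [multsE_pos hr hrk] at hc
        exact count_eq_one_of_mem_range_two hi hc
      · rw [multsE_neg hr hrk] at hc
        exact count_eq_one_of_mem_range_two hi hc
    · rintro m hm hmM ⟨j, rfl⟩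
      rw [hM] at hmM
      have hj := Nat.le_of_mul_le_mul_left hmM (by omega)
      obtain ⟨j, rfl⟩ : ∃ u, j = u + 1 :=
        Nat.exists_eq_succ_of_ne_zero (by rintro rfl; simp at hm)
      have := heven j hj
      rwa [show k * (2 * j + 2) = 2 * k * (j + 1) by ring] at this
    · intro t hi
      rw [hM]
      rcases mem_partsE.1 (h1 _ hi) with ⟨j, hj, h⟩ | ⟨j, hj, h⟩ | ⟨j, hj, h⟩ | ⟨j, hj, h⟩
      · exact absurd ⟨_, h⟩ (not_dvd_add_mul hr (by omega) j)
      · exact absurd ⟨_, h⟩ (not_dvd_add_mul (by omega) (by omega) j)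
      · rw [← h]
        nlinarith
      · have := Nat.eq_of_mul_eq_mul_left hk h
        omega
    · intro i hi hmod
      rw [hM]
      obtain ⟨t, rfl⟩ := (c1 i).1 hmod
      rcases mem_partsE.1 (h1 _ hi) with ⟨j, hj, h⟩ | ⟨j, hj, h⟩ | ⟨j, hj, h⟩ | ⟨j, hj, h⟩
      -- The case j = N is admissible because 2r < k.
      · rw [← h]
        nlinarith
      · exact absurd h.symm (add_mul_ne_sub_add_mul hr hrk t j)
      · exact absurd ⟨_, h.symm⟩ (not_dvd_add_mul hr (by omega) t)
      · exact absurd ⟨_, h.symm⟩ (not_dvd_add_mul hr (by omega) t)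
    · intro i hi hmod
      rw [hM]
      obtain ⟨t, rfl⟩ := (c2 i).1 hmod
      rcases mem_partsE.1 (h1 _ hi) with ⟨j, hj, h⟩ | ⟨j, hj, h⟩ | ⟨j, hj, h⟩ | ⟨j, hj, h⟩
      · exact absurd h (add_mul_ne_sub_add_mul hr hrk j t)
      · rw [← h]
        have : k * (j + 1) ≤ k * N := Nat.mul_le_mul_left k hj
        have : 2 * k * N = 2 * (k * N) := mul_assoc _ _ _
        have : k * (j + 1) = k * j + k := by ring
        omega
      · exact absurd ⟨_, h.symm⟩ (not_dvd_add_mul (by omega) (by omega) t)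
      · exact absurd ⟨_, h.symm⟩ (not_dvd_add_mul (by omega) (by omega) t)

/-! ### Comparison of coefficients -/

lemma F_eq_coeff (n : ℕ) : (F k r n : ℤ) =
    (∏ i ∈ partsF k r (2 * (n + 1)), ∑ c ∈ multsF k (n + 1) i,
      (Polynomial.X : Polynomial ℤ) ^ (i * c)).coeff n := by
  rw [coeff_prod_sum_X_pow, F]
  · simp_rw [isCountedByF_iff hr hrk]
  · intro i hi
    have : 0 < k := by omega
    have : 0 < 3 * k - r := by omega
    rcases mem_partsF.1 hi with ⟨j, -, rfl⟩ | ⟨j, -, rfl⟩ | ⟨j, -, rfl⟩ | ⟨j, -, rfl⟩ <;> positivity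

/-- The fibres of N = M / (2k) are described by `isCountedByE_iff`. Since N ≤ n, the range of
summation is larger than necessary; it is the one in `generating_function_identity`. -/
lemma E_eq_coeff (n : ℕ) : (E k r n : ℤ) =
    (∑ N ∈ range (2 * (n + 1) + 1), ∏ i ∈ partsE k r N, ∑ c ∈ multsE k (n + 1) i,
      (Polynomial.X : Polynomial ℤ) ^ (i * c)).coeff n := by
  classical
  have hk : 0 < k := by omega
  have hdvd : ∀ p : n.Partition, 2 * k ∣ largestEvenMultiple k p := fun p =>
    dvd_multiset_sup _ fun x hx => (Multiset.mem_filter.1 hx).2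
  have hle : ∀ p : n.Partition, largestEvenMultiple k p ≤ n := fun p =>
    Multiset.sup_le.2 fun i hi => p.le_of_mem_parts (Multiset.mem_filter.1 hi).1
  rw [E, card_eq_sum_card_fiberwise (f := fun p => largestEvenMultiple k p / (2 * k))
    (t := range (2 * (n + 1) + 1)), Polynomial.finsetSum_coeff, Nat.cast_sum]
  · refine sum_congr rfl fun N _ => ?_
    rw [coeff_prod_sum_X_pow, Nat.cast_inj, filter_filter]
    · congr 1
      ext p
      rw [mem_filter, mem_filter, ← isCountedByE_iff hr hrk,
        Nat.div_eq_iff_eq_mul_right (by omega) (hdvd p)]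
    · intro i hi
      have : 0 < k - r := by omega
      rcases mem_partsE.1 hi with ⟨j, -, rfl⟩ | ⟨j, -, rfl⟩ | ⟨j, -, rfl⟩ | ⟨j, -, rfl⟩ <;>
        positivity
  · intro p _
    have := (Nat.div_le_self (largestEvenMultiple k p) (2 * k)).trans (hle p)
    exact mem_coe.2 (mem_range.2 (this.trans_lt (by omega)))

theorem E_eq_F (n : ℕ) : E k r n = F k r n := by
  rw [← Nat.cast_inj (R := ℤ), E_eq_coeff hr hrk, F_eq_coeff hr hrk, ← sub_eq_zero,
    ← Polynomial.coeff_sub]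
  -- The coefficient of X^n depends only on the class modulo X^(n+1), and in that quotient X^k is
  -- nilpotent.
  refine Polynomial.X_pow_dvd_iff.1 ?_ n (Nat.lt_succ_self n)
  rw [← Ideal.mem_span_singleton, ← Ideal.Quotient.eq]
  set φ := Ideal.Quotient.mk (Ideal.span {(Polynomial.X : Polynomial ℤ) ^ n.succ})
  have hX : φ Polynomial.X ^ (n + 1) = 0 := by
    rw [← map_pow]
    exact Ideal.Quotient.eq_zero_iff_mem.2 (Ideal.mem_span_singleton_self _)
  simp only [map_sum, map_prod, map_pow]
  rw [prod_partsF hr hrk, sum_congr rfl fun N _ => prod_partsE hr hrk (φ Polynomial.X) (n + 1) N]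
  refine generating_function_identity ?_ ?_
  · rw [← pow_mul]
    exact pow_eq_zero_of_le (Nat.le_mul_of_pos_left _ (by omega)) hX
  · rw [← pow_add]
    congr 1
    omega

end Products

end PartitionEF

theorem mainTheorem12 (k r : ℕ) (hk : 3 ≤ k) (hr : 0 < r) (hrk : 2 * r < k)
    (n : ℕ) (hn : 1 ≤ n) : PartitionEF.E k r n = PartitionEF.F k r n :=
  PartitionEF.E_eq_F hr hrk n
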